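/- For $p\in(0,1)$ and $x>0$ let $m_p(x)>0$ be the $p$-quantile of the gamma distribution with shape parameter $x$ and scale parameter $1$, i.e. the unique positive number with $$\int_0^{m_p(x)}e^{-t}t^{x-1}\,dt=p\,\Gamma(x).$$ Put $u_p(x)=e^{-\frac{\log p}{x}}m_p(x)$ for $x>0$ and $u_p(0)=e^{-\gamma}$, where $\gamma$ is the Euler–Mascheroni constant. Then, for every $p\in(0,1)$, $u_p$ belongs to $C^\infty([0,\infty))$ (with one-sided derivatives at $0$), $\lim_{x\to0^+}u_p^{(k)}(x)=u_p^{(k)}(0)$ for every $k\ge 0$, and for every integer $n\ge 0$, $$m_p(x)=e^{\frac{\log p}{x}}\left(\sum_{k=0}^n\frac{u_p^{(k)}(0)}{k!}x^k+O\left(x^{n+1}\right)\right)\quad\text{as } x\to0^+.$$ Moreover, for every $k\ge 0$ the coefficient $u_p^{(k)}(0)$ does not depend on $p\in(0,1)$. -/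

import Mathlib

open Set Filter Topology Asymptotics
open scoped ContDiff

/-- `y` is a `p`-quantile of the gamma distribution with shape parameter `x` and scale
parameter `1`: `y > 0` and `∫₀^y e^{-t} t^{x-1} dt = p Γ(x)`. -/
def IsGammaQuantile (p x y : ℝ) : Prop :=
  0 < y ∧ ∫ t in (0 : ℝ)..y, Real.exp (-t) * t ^ (x - 1) = p * Real.Gamma x

theorem existsUnique_isGammaQuantile {p x : ℝ} (hp : p ∈ Ioo (0 : ℝ) 1) (hx : 0 < x) :
    ∃! y, IsGammaQuantile p x y := by
  have hG : 0 < Real.Gamma x := Real.Gamma_pos_of_pos hx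
  have hint := Real.GammaIntegral_convergent hx
  have hII : ∀ a b : ℝ, 0 ≤ a → 0 ≤ b → IntervalIntegrable
      (fun t : ℝ => Real.exp (-t) * t ^ (x - 1)) MeasureTheory.volume a b := by
    intro a b ha hb
    rw [intervalIntegrable_iff]
    exact hint.mono_set fun t ht => lt_of_le_of_lt (le_min ha hb) ht.1
  have hlt : p * Real.Gamma x < Real.Gamma x := by nlinarith [hp.2]
  have hpos : 0 < p * Real.Gamma x := mul_pos hp.1 hG
  have hlim := MeasureTheory.intervalIntegral_tendsto_integral_Ioi 0 hint tendsto_id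
  rw [← Real.Gamma_eq_integral hx] at hlim
  obtain ⟨b, hb, hb0⟩ :=
    ((hlim.eventually (lt_mem_nhds hlt)).and (eventually_ge_atTop (0 : ℝ))).exists
  have hcont : ContinuousOn
      (fun y => ∫ t in (0 : ℝ)..y, Real.exp (-t) * t ^ (x - 1)) (Icc 0 b) := by
    rw [← uIcc_of_le hb0]
    apply intervalIntegral.continuousOn_primitive_interval
    rw [uIcc_of_le hb0, integrableOn_Icc_iff_integrableOn_Ioc]
    exact hint.mono_set fun t ht => ht.1
  obtain ⟨y, hy, hyeq⟩ := intermediate_value_Icc hb0 hcont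
    (show p * Real.Gamma x ∈ Icc _ _ from ⟨by simpa using hpos.le, hb.le⟩)
  have hy0 : y ≠ 0 := by
    rintro rfl
    simp only [intervalIntegral.integral_same] at hyeq
    exact hpos.ne hyeq
  have key : ∀ a c : ℝ, IsGammaQuantile p x a → IsGammaQuantile p x c → ¬ a < c := by
    intro a c ha hc hac
    have h1 := intervalIntegral.integral_add_adjacent_intervals
      (hII 0 a le_rfl ha.1.le) (hII a c ha.1.le hc.1.le)
    have h2 := intervalIntegral.intervalIntegral_pos_of_pos_on (hII a c ha.1.le hc.1.le)
      (fun t ht => mul_pos (Real.exp_pos _) (Real.rpow_pos_of_pos (ha.1.trans ht.1) _)) hac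
    rw [ha.2, hc.2] at h1
    linarith
  refine ⟨y, ⟨lt_of_le_of_ne hy.1 hy0.symm, hyeq⟩, fun z hz => ?_⟩
  have hyq : IsGammaQuantile p x y := ⟨lt_of_le_of_ne hy.1 hy0.symm, hyeq⟩
  exact le_antisymm (not_lt.1 (key y z hyq hz)) (not_lt.1 (key z y hz hyq))

/-- The `p`-quantile `m_p(x)` of the gamma distribution with shape `x` and scale `1`, that is,
the unique `y` with `IsGammaQuantile p x y` (for `0 < p < 1` and `x > 0`). -/
noncomputable def gammaQuantile (p x : ℝ) : ℝ := sInf {y | IsGammaQuantile p x y}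

theorem isGammaQuantile_gammaQuantile {p x : ℝ} (hp : p ∈ Ioo (0 : ℝ) 1) (hx : 0 < x) :
    IsGammaQuantile p x (gammaQuantile p x) := by
  obtain ⟨y, hy, huniq⟩ := existsUnique_isGammaQuantile hp hx
  have h : {y | IsGammaQuantile p x y} = {y} :=
    Set.ext fun z => ⟨fun hz => huniq z hz, fun hz => by rw [mem_singleton_iff.1 hz]; exact hy⟩
  rw [gammaQuantile, h, csInf_singleton]
  exact hy

/-- The function `u_p` on `[0, ∞)`: `u_p(x) = e^{-(log p)/x} m_p(x)` for `x > 0`, and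
`u_p(0) = e^{-γ}` with `γ` the Euler–Mascheroni constant. Values at `x < 0` are irrelevant. -/
noncomputable def scaledGammaQuantile (p x : ℝ) : ℝ :=
  if 0 < x then Real.exp (-(Real.log p / x)) * gammaQuantile p x
  else Real.exp (-Real.eulerMascheroniConstant)

/-- `u_p^{(k)}(0)`: the `k`-th (one-sided) derivative at `0` of `u_p` on `[0, ∞)`. -/
noncomputable def scaledGammaQuantileDerivZero (p : ℝ) (k : ℕ) : ℝ :=
  iteratedDerivWithin k (scaledGammaQuantile p) (Ici 0) 0

/-! Integrating the exponential series termwise gives, for x > 0, ∫₀^y e^{-t} t^{x-1} dt = (y^x /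
x)(1 - x y K(x, y)), with K smooth in (x, y) for x > -1. Put y = s(x) e^v with s(x) = e^{(log p)/x},
so that v = log u_p(x). Taking logarithms in the quantile equation and dividing by x cancels the
singular term (log p)/x and leaves v = L(x) + y M(x, y), where L(x) = log Γ(1 + x) / x and M(x, y) =
-log(1 - x y K) / (x y), both with removable singularities.

Since s extends smoothly by 0 to x ≤ 0, this equation is smooth near every solution with x ≥ 0, and
its v-derivative does not vanish. The implicit function theorem
(`exists_contDiffAt_quantileEquation`) and uniqueness of the quantile make u_p smooth up to 0. As s
is flat at 0, u_p - e^L is O(x^n) for every n (`scaledGammaQuantile_sub_isBigO`), so u_p has the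
Taylor coefficients of e^L, where p does not occur. -/

open MeasureTheory BoundedContinuousFunction

/-! ### Joint smoothness of the incomplete gamma series -/

/-- The bounded sequence `n ↦ 1 / (n + 1)`. -/
noncomputable def reciprocalSeq : ℕ →ᵇ ℝ :=
  BoundedContinuousFunction.ofNormedAddCommGroupDiscrete (fun n : ℕ => ((n : ℝ) + 1)⁻¹) 1 (by
    intro n
    rw [Real.norm_of_nonneg (by positivity)]
    exact inv_le_one_of_one_le₀ (by linarith [n.cast_nonneg (α := ℝ)]))

theorem reciprocalSeq_apply (n : ℕ) : reciprocalSeq n = ((n : ℝ) + 1)⁻¹ := rfl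

/-- The left shift on bounded sequences. -/
noncomputable def boundedSeqShift : (ℕ →ᵇ ℝ) →L[ℝ] (ℕ →ᵇ ℝ) :=
  LinearMap.mkContinuous
    { toFun := fun f => f.compContinuous ⟨fun n : ℕ => n + 1, continuous_of_discreteTopology⟩
      map_add' := fun f g => by ext; rfl
      map_smul' := fun c f => by ext; rfl } 1 (fun f => by
    rw [one_mul]
    exact (BoundedContinuousFunction.norm_le (norm_nonneg f)).2 fun n => f.norm_coe_le_norm (n + 1))

theorem boundedSeqShift_apply (f : ℕ →ᵇ ℝ) (n : ℕ) : boundedSeqShift f n = f (n + 1) := rfl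

theorem boundedSeqShift_pow_apply (k : ℕ) (f : ℕ →ᵇ ℝ) (n : ℕ) :
    (boundedSeqShift ^ k) f n = f (n + k) := by
  induction k generalizing n with
  | zero => simp
  | succ k ih =>
    rw [pow_succ', mul_apply_eq_comp, boundedSeqShift_apply, ih]
    congr 1; ring

/-- The exponential of a bounded operator, applied to a vector. -/
noncomputable def expApply {E : Type*} [NormedAddCommGroup E] [NormedSpace ℝ E]
    (T : E →L[ℝ] E) (v : E) : E :=
  NormedSpace.exp T v

theorem hasSum_expApply {E : Type*} [NormedAddCommGroup E] [NormedSpace ℝ E] [CompleteSpace E]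
    (T : E →L[ℝ] E) (v : E) :
    HasSum (fun n : ℕ => (n.factorial : ℝ)⁻¹ • (T ^ n) v) (expApply T v) :=
  (NormedSpace.exp_series_hasSum_exp' (𝕂 := ℝ) T).mapL (ContinuousLinearMap.apply ℝ E v)

theorem ContDiffAt.expApply {E F : Type*} [NormedAddCommGroup E] [NormedSpace ℝ E]
    [CompleteSpace E] [NormedAddCommGroup F] [NormedSpace ℝ F] {T : F → E →L[ℝ] E} {v : F → E}
    {z : F} {n : ℕ∞ω} (hT : ContDiffAt ℝ n T z) (hv : ContDiffAt ℝ n v z) :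
    ContDiffAt ℝ n (fun z => expApply (T z) (v z)) z :=
  ((NormedSpace.exp_analytic (𝕂 := ℝ) (T z)).contDiffAt.comp z hT).clm_apply hv

/-- The entire function of `y` given by `∑ (-y) ^ n / ((n + 1)! (n + 1 + x))`, written so that joint
smoothness in `x > -1` and `y` is visible. -/
noncomputable def gammaKernel (x y : ℝ) : ℝ :=
  expApply ((-y) • boundedSeqShift)
    (reciprocalSeq ^ 2 * Ring.inverse (1 + x • reciprocalSeq)) 0

theorem one_add_smul_reciprocalSeq_pos {x : ℝ} (hx : -1 < x) (n : ℕ) :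
    0 < 1 + x * ((n : ℝ) + 1)⁻¹ := by
  have hn : (0 : ℝ) < (n : ℝ) + 1 := by positivity
  have : 1 + x * ((n : ℝ) + 1)⁻¹ = (n + 1 + x) / (n + 1) := by field_simp
  rw [this]
  exact div_pos (by linarith [n.cast_nonneg (α := ℝ)]) hn

/-- Every entry lies between 1 and 1 + x, so the entrywise inverses are bounded by 1 / min(1, 1 +
x). -/
theorem isUnit_one_add_smul_reciprocalSeq {x : ℝ} (hx : -1 < x) :
    IsUnit (1 + x • reciprocalSeq) := by
  have hbd : ∀ n : ℕ, ‖(1 + x * ((n : ℝ) + 1)⁻¹)⁻¹‖ ≤ (min 1 (1 + x))⁻¹ := by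
    intro n
    rw [Real.norm_of_nonneg (inv_nonneg.2 (one_add_smul_reciprocalSeq_pos hx n).le)]
    apply inv_anti₀ (lt_min one_pos (by linarith))
    have h0 : (0 : ℝ) < ((n : ℝ) + 1)⁻¹ := by positivity
    have h1 : ((n : ℝ) + 1)⁻¹ ≤ 1 :=
      inv_le_one_of_one_le₀ (by linarith [n.cast_nonneg (α := ℝ)])
    rcases le_total 0 x with h | h
    · exact (min_le_left _ _).trans (by nlinarith)
    · exact (min_le_right _ _).trans (by nlinarith)
  refine IsUnit.of_mul_eq_one
    (BoundedContinuousFunction.ofNormedAddCommGroupDiscrete _ _ hbd) ?_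
  ext n
  exact mul_inv_cancel₀ (one_add_smul_reciprocalSeq_pos hx n).ne'

theorem ringInverse_one_add_smul_reciprocalSeq_apply {x : ℝ} (hx : -1 < x) (n : ℕ) :
    Ring.inverse (1 + x • reciprocalSeq) n = (1 + x * ((n : ℝ) + 1)⁻¹)⁻¹ := by
  have h := congrArg (fun f : ℕ →ᵇ ℝ => f n)
    (Ring.mul_inverse_cancel _ (isUnit_one_add_smul_reciprocalSeq hx))
  exact eq_inv_of_mul_eq_one_right h

theorem hasSum_gammaKernel {x : ℝ} (hx : -1 < x) (y : ℝ) :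
    HasSum (fun n : ℕ => (-y) ^ n / (((n + 1).factorial : ℝ) * (n + 1 + x))) (gammaKernel x y) := by
  refine ((hasSum_expApply ((-y) • boundedSeqShift)
    (reciprocalSeq ^ 2 * Ring.inverse (1 + x • reciprocalSeq))).mapL
      (BoundedContinuousFunction.evalCLM ℝ (0 : ℕ))).congr_fun fun n => ?_
  have h3 : (0 : ℝ) < n + 1 + x := by linarith [n.cast_nonneg (α := ℝ)]
  have h4 := (one_add_smul_reciprocalSeq_pos hx n).ne'
  simp only [BoundedContinuousFunction.evalCLM_apply,
    smul_pow, _root_.smul_apply, BoundedContinuousFunction.coe_smul,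
    boundedSeqShift_pow_apply, BoundedContinuousFunction.coe_mul, Pi.mul_apply,
    ringInverse_one_add_smul_reciprocalSeq_apply hx, BoundedContinuousFunction.coe_pow,
    Pi.pow_apply, reciprocalSeq_apply, zero_add, smul_eq_mul]
  rw [Nat.factorial_succ]
  push_cast
  have h5 : ((n : ℝ) + 1) ≠ 0 := by positivity
  have h6 : 1 + x * ((n : ℝ) + 1)⁻¹ = (n + 1 + x) / (n + 1) := by field_simp
  rw [h6]
  field_simp

/-- With S the shift and a(n) = 1 / ((n + 1)(n + 1 + x)), the series is the zeroth entry of exp(-yS)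
a. Inversion and exponential are smooth in Banach algebras, so no termwise differentiation is
needed. -/
theorem contDiffAt_gammaKernel {z : ℝ × ℝ} (hz : -1 < z.1) :
    ContDiffAt ℝ ∞ (fun z : ℝ × ℝ => gammaKernel z.1 z.2) z := by
  have h2 : ContDiffAt ℝ ∞ (fun z : ℝ × ℝ => Ring.inverse (1 + z.1 • reciprocalSeq)) z := by
    obtain ⟨u, hu⟩ := isUnit_one_add_smul_reciprocalSeq hz
    have h := contDiffAt_ringInverse ℝ (n := ∞) u
    rw [hu] at h
    exact h.comp (f := fun z : ℝ × ℝ => 1 + z.1 • reciprocalSeq) z (by fun_prop)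
  have h3 := ContDiffAt.expApply (T := fun z : ℝ × ℝ => (-z.2) • boundedSeqShift) (by fun_prop)
    ((contDiffAt_const (c := reciprocalSeq ^ 2)).mul h2)
  exact (BoundedContinuousFunction.evalCLM ℝ (0 : ℕ)).contDiff.contDiffAt.comp z h3

theorem integral_exp_neg_mul_rpow_eq_gammaKernel {x y : ℝ} (hx : 0 < x) (hy : 0 < y) :
    ∫ t in (0 : ℝ)..y, Real.exp (-t) * t ^ (x - 1) =
      y ^ x / x * (1 - x * y * gammaKernel x y) := by
  have hpt : ∀ t : ℝ, HasSum (fun n : ℕ => (-t) ^ n / (n.factorial : ℝ) * t ^ (x - 1))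
      (Real.exp (-t) * t ^ (x - 1)) := fun t => by
    have := NormedSpace.expSeries_div_hasSum_exp (-t)
    rw [← Real.exp_eq_exp_ℝ] at this
    exact this.mul_right _
  have hpt' : ∀ t : ℝ, HasSum (fun n : ℕ => t ^ n / (n.factorial : ℝ) * t ^ (x - 1))
      (Real.exp t * t ^ (x - 1)) := fun t => by
    have := NormedSpace.expSeries_div_hasSum_exp t
    rw [← Real.exp_eq_exp_ℝ] at this
    exact this.mul_right _
  have hint : HasSum (fun n : ℕ => ∫ t in (0 : ℝ)..y, (-t) ^ n / (n.factorial : ℝ) * t ^ (x - 1))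
      (∫ t in (0 : ℝ)..y, Real.exp (-t) * t ^ (x - 1)) := by
    refine intervalIntegral.hasSum_integral_of_dominated_convergence
      (fun (n : ℕ) (t : ℝ) => t ^ n / (n.factorial : ℝ) * t ^ (x - 1)) ?_ ?_ ?_ ?_ ?_
    · intro n
      exact (by fun_prop : Measurable fun t : ℝ =>
        (-t) ^ n / (n.factorial : ℝ) * t ^ (x - 1)).aestronglyMeasurable
    · intro n
      refine ae_of_all _ fun t ht => ?_
      rw [uIoc_of_le hy.le] at ht
      rw [norm_mul, norm_div, norm_pow, norm_neg, Real.norm_of_nonneg ht.1.le,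
        Real.norm_of_nonneg (Real.rpow_nonneg ht.1.le _), Real.norm_of_nonneg (by positivity)]
    · exact ae_of_all _ fun t _ => (hpt' t).summable
    -- The dominating series sums to e^t t^(x-1), integrable since x > 0.
    · simp_rw [fun t => (hpt' t).tsum_eq]
      exact (intervalIntegral.intervalIntegrable_rpow' (by linarith)).continuousOn_mul
        Real.continuous_exp.continuousOn
    · exact ae_of_all _ fun t _ => hpt t
  have hterm : ∀ n : ℕ, ∫ t in (0 : ℝ)..y, (-t) ^ n / (n.factorial : ℝ) * t ^ (x - 1) =
      (-1) ^ n / (n.factorial : ℝ) * (y ^ x * y ^ n / (n + x)) := by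
    intro n
    have hn : (0 : ℝ) < n + x := by positivity
    have h1 : ∫ t in (0 : ℝ)..y, (-t) ^ n / (n.factorial : ℝ) * t ^ (x - 1) =
        ∫ t in (0 : ℝ)..y, (-1) ^ n / (n.factorial : ℝ) * t ^ (n + x - 1) := by
      refine intervalIntegral.integral_congr_ae (ae_of_all _ fun t ht => ?_)
      rw [uIoc_of_le hy.le] at ht
      rw [add_sub_assoc, Real.rpow_add ht.1, Real.rpow_natCast, neg_pow]
      ring
    rw [h1, intervalIntegral.integral_const_mul, integral_rpow (Or.inl (by linarith)),
      sub_add_cancel, Real.zero_rpow hn.ne', sub_zero, Real.rpow_add hy, Real.rpow_natCast,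
      mul_comm (y ^ n)]
  simp_rw [hterm] at hint
  have hK := ((hasSum_gammaKernel (by linarith : -1 < x) y).mul_left (-(y ^ x * y)))
  have hK' : HasSum (fun n : ℕ =>
      (-1) ^ (n + 1) / ((n + 1).factorial : ℝ) * (y ^ x * y ^ (n + 1) / ((n + 1 : ℕ) + x)))
      (-(y ^ x * y) * gammaKernel x y) := by
    refine hK.congr_fun fun n => ?_
    have h3 : (0 : ℝ) < n + 1 + x := by positivity
    push_cast
    rw [neg_pow y]
    field_simp
    ring
  -- The term n = 0 contributes y^x / x; the others form the kernel.
  have hsum := (hasSum_nat_add_iff (f := fun n : ℕ =>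
    (-1) ^ n / (n.factorial : ℝ) * (y ^ x * y ^ n / (n + x))) 1).1 hK'
  rw [hint.unique hsum]
  simp only [Finset.range_one, Finset.sum_singleton, pow_zero, Nat.factorial_zero, Nat.cast_one,
    Nat.cast_zero, zero_add, mul_one, div_one, one_mul]
  field_simp
  ring

/-! ### Removable singularities of logarithmic quotients -/

theorem AnalyticAt.dslope {f : ℝ → ℝ} {a z : ℝ} (ha : AnalyticAt ℝ f a) (hz : AnalyticAt ℝ f z) :
    AnalyticAt ℝ (dslope f a) z := by
  rcases eq_or_ne z a with rfl | h
  · obtain ⟨q, hq⟩ := ha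
    exact ⟨_, hq.has_fpower_series_dslope_fslope⟩
  · have h1 : AnalyticAt ℝ (fun w => (w - a)⁻¹ * (f w - f a)) z :=
      ((analyticAt_id.sub analyticAt_const).inv (sub_ne_zero.2 h)).mul (hz.sub analyticAt_const)
    refine h1.congr ?_
    filter_upwards [isOpen_ne.mem_nhds h] with w hw
    rw [dslope_of_ne _ hw, slope_def_field]
    ring

theorem Real.analyticAt_Gamma {x : ℝ} (hx : 0 < x) : AnalyticAt ℝ Real.Gamma x := by
  have h1 : AnalyticAt ℂ Complex.Gamma (x : ℂ) := by
    refine DifferentiableOn.analyticAt (s := {s : ℂ | 0 < s.re}) (fun s hs => ?_)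
      ((isOpen_lt continuous_const Complex.continuous_re).mem_nhds (by simpa using hx))
    refine (Complex.differentiableAt_Gamma s fun m hm => ?_).differentiableWithinAt
    have : 0 < s.re := hs
    rw [hm] at this
    simp at this
    linarith [m.cast_nonneg (α := ℝ)]
  exact h1.re_ofReal

/-- `x ↦ log Γ(1 + x) / x`, extended by continuity to `0`. -/
noncomputable def logGammaSlope : ℝ → ℝ := dslope (fun x => Real.log (Real.Gamma (1 + x))) 0

theorem contDiffAt_logGammaSlope {x : ℝ} (hx : -1 < x) : ContDiffAt ℝ ∞ logGammaSlope x := by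
  have key : ∀ x : ℝ, -1 < x → AnalyticAt ℝ (fun x => Real.log (Real.Gamma (1 + x))) x := by
    intro x hx
    have h1 : AnalyticAt ℝ (fun x : ℝ => Real.Gamma (1 + x)) x :=
      (Real.analyticAt_Gamma (by linarith)).comp (analyticAt_const.add analyticAt_id)
    exact h1.log (Real.Gamma_pos_of_pos (by linarith))
  exact ((key 0 (by norm_num)).dslope (key x hx)).contDiffAt

theorem logGammaSlope_zero : logGammaSlope 0 = -Real.eulerMascheroniConstant := by
  have h : HasDerivAt Real.Gamma (-Real.eulerMascheroniConstant) (1 + 0) := by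
    simpa using Real.hasDerivAt_Gamma_one
  have h2 := (h.comp_const_add (1 : ℝ) 0).log (by simp)
  rw [logGammaSlope, dslope_same, h2.deriv]
  simp

theorem logGammaSlope_of_ne {x : ℝ} (hx : x ≠ 0) :
    logGammaSlope x = Real.log (Real.Gamma (1 + x)) / x := by
  rw [logGammaSlope, dslope_of_ne _ hx, slope_def_field]
  simp

/-- `z ↦ log (1 + z) / z`, extended by continuity to `0`. -/
noncomputable def logOneAddSlope : ℝ → ℝ := dslope (fun z => Real.log (1 + z)) 0

theorem contDiffAt_logOneAddSlope {z : ℝ} (hz : 0 < 1 + z) : ContDiffAt ℝ ∞ logOneAddSlope z := by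
  have key : ∀ z : ℝ, 0 < 1 + z → AnalyticAt ℝ (fun z => Real.log (1 + z)) z := fun z hz =>
    (analyticAt_const.add analyticAt_id).log hz
  exact ((key 0 (by norm_num)).dslope (key z hz)).contDiffAt

theorem mul_logOneAddSlope (z : ℝ) : z * logOneAddSlope z = Real.log (1 + z) := by
  have := sub_smul_dslope (fun z => Real.log (1 + z)) 0 z
  simpa [logOneAddSlope] using this

/-- The quotient of `log (1 - x y K(x, y)) / x` by `-y`, where `K` is `gammaKernel`. -/
noncomputable def gammaLogCorrection (x y : ℝ) : ℝ :=
  gammaKernel x y * logOneAddSlope (-(x * y * gammaKernel x y))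

theorem contDiffAt_gammaLogCorrection {z : ℝ × ℝ} (hz : -1 < z.1)
    (hz' : 0 < 1 - z.1 * z.2 * gammaKernel z.1 z.2) :
    ContDiffAt ℝ ∞ (fun z : ℝ × ℝ => gammaLogCorrection z.1 z.2) z := by
  have h1 := contDiffAt_gammaKernel hz
  have h2 : ContDiffAt ℝ ∞ (fun z : ℝ × ℝ => -(z.1 * z.2 * gammaKernel z.1 z.2)) z :=
    ((contDiffAt_fst.mul contDiffAt_snd).mul h1).neg
  exact h1.mul ((contDiffAt_logOneAddSlope (by linarith)).comp (f := fun z : ℝ × ℝ =>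
    -(z.1 * z.2 * gammaKernel z.1 z.2)) z h2)

/-! ### The logarithm of the lower incomplete gamma function -/

/-- The lower incomplete gamma function. -/
noncomputable def lowerGamma (x y : ℝ) : ℝ := ∫ t in (0 : ℝ)..y, Real.exp (-t) * t ^ (x - 1)

theorem intervalIntegrable_gammaIntegrand {x : ℝ} (hx : 0 < x) (a b : ℝ) :
    IntervalIntegrable (fun t : ℝ => Real.exp (-t) * t ^ (x - 1)) volume a b :=
  (intervalIntegral.intervalIntegrable_rpow' (by linarith)).continuousOn_mul
    (by fun_prop)

theorem lowerGamma_pos {x y : ℝ} (hx : 0 < x) (hy : 0 < y) : 0 < lowerGamma x y :=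
  intervalIntegral.intervalIntegral_pos_of_pos_on (intervalIntegrable_gammaIntegrand hx _ _)
    (fun _ ht => mul_pos (Real.exp_pos _) (Real.rpow_pos_of_pos ht.1 _)) hy

theorem hasDerivAt_lowerGamma {x y : ℝ} (hx : 0 < x) (hy : 0 < y) :
    HasDerivAt (lowerGamma x) (Real.exp (-y) * y ^ (x - 1)) y := by
  refine intervalIntegral.integral_hasDerivAt_right (intervalIntegrable_gammaIntegrand hx _ _)
    ?_ ?_
  · exact (by fun_prop : Measurable fun t : ℝ =>
      Real.exp (-t) * t ^ (x - 1)).stronglyMeasurable.stronglyMeasurableAtFilter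
  · exact (by fun_prop : ContinuousAt (fun t : ℝ => Real.exp (-t)) y).mul
      (Real.continuousAt_rpow_const _ _ (Or.inl hy.ne'))

theorem one_sub_mul_gammaKernel_pos {x y : ℝ} (hx : 0 < x) (hy : 0 < y) :
    0 < 1 - x * y * gammaKernel x y := by
  have h := lowerGamma_pos hx hy
  rw [lowerGamma, integral_exp_neg_mul_rpow_eq_gammaKernel hx hy] at h
  exact (pos_iff_pos_of_mul_pos h).1 (div_pos (Real.rpow_pos_of_pos hy x) hx)

theorem log_sub_mul_gammaLogCorrection {x y : ℝ} (hx : 0 < x) (hy : 0 < y) :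
    Real.log y - y * gammaLogCorrection x y = Real.log (x * lowerGamma x y) / x := by
  have h1 := one_sub_mul_gammaKernel_pos hx hy
  have h2 := mul_logOneAddSlope (-(x * y * gammaKernel x y))
  rw [← sub_eq_add_neg] at h2
  have h3 : x * lowerGamma x y = y ^ x * (1 - x * y * gammaKernel x y) := by
    rw [lowerGamma, integral_exp_neg_mul_rpow_eq_gammaKernel hx hy]
    field_simp
  rw [h3, Real.log_mul (Real.rpow_pos_of_pos hy x).ne' h1.ne', Real.log_rpow hy, ← h2,
    gammaLogCorrection]
  field_simp
  ring

/-! ### The flat factor and the quantile equation -/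

/-- The smooth extension of `x ↦ e ^ (log p / x)` by `0` to `x ≤ 0`. -/
noncomputable def quantileScale (p x : ℝ) : ℝ := expNegInvGlue (x / -Real.log p)

theorem quantileScale_of_pos {p x : ℝ} (hp : p ∈ Ioo (0 : ℝ) 1) (hx : 0 < x) :
    quantileScale p x = Real.exp (Real.log p / x) := by
  have hl := Real.log_neg hp.1 hp.2
  rw [quantileScale, expNegInvGlue, if_neg (not_le.2 (div_pos hx (neg_pos.2 hl)))]
  congr 1
  rw [inv_div, neg_div, neg_neg]

theorem quantileScale_zero (p : ℝ) : quantileScale p 0 = 0 := by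
  rw [quantileScale, zero_div, expNegInvGlue.zero]

theorem contDiff_quantileScale (p : ℝ) : ContDiff ℝ ∞ (quantileScale p) :=
  expNegInvGlue.contDiff.comp (contDiff_id.div_const _)

theorem quantileScale_isBigO {p : ℝ} (hp : p ∈ Ioo (0 : ℝ) 1) (n : ℕ) :
    quantileScale p =O[𝓝[>] 0] fun x : ℝ => x ^ n := by
  have hl := Real.log_neg hp.1 hp.2
  have h1 := expNegInvGlue.tendsto_polynomial_inv_mul_zero (Polynomial.X ^ n)
  have h2 : Tendsto (fun x : ℝ => x / -Real.log p) (𝓝[>] 0) (𝓝 0) := by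
    have : Continuous fun x : ℝ => x / -Real.log p := by fun_prop
    simpa using (this.tendsto 0).mono_left nhdsWithin_le_nhds
  have h3 := (h1.comp h2).isBigO_one ℝ
  have h4 := h3.mul (isBigO_refl (fun x : ℝ => x ^ n) (𝓝[>] 0))
    |>.const_mul_left ((-Real.log p)⁻¹ ^ n)
  refine h4.congr' ?_ (by simp [EventuallyEq.refl])
  filter_upwards [self_mem_nhdsWithin] with x hx
  have hx : (0 : ℝ) < x := hx
  have : Real.log p ≠ 0 := hl.ne
  simp only [Function.comp, quantileScale, Polynomial.eval_pow, Polynomial.eval_X]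
  have h5 : (-Real.log p)⁻¹ * (x / -Real.log p)⁻¹ * x = 1 := by field_simp
  calc _ = ((-Real.log p)⁻¹ * (x / -Real.log p)⁻¹ * x) ^ n * expNegInvGlue (x / -Real.log p) := by
        rw [mul_pow, mul_pow]; ac_rfl
    _ = _ := by rw [h5, one_pow, one_mul]

/-- The equation satisfied by `v = log u_p(x)`, as a smooth function of `(x, v)`. -/
noncomputable def quantileEquation (p : ℝ) (z : ℝ × ℝ) : ℝ :=
  z.2 - logGammaSlope z.1 - quantileScale p z.1 * Real.exp z.2 *
    gammaLogCorrection z.1 (quantileScale p z.1 * Real.exp z.2)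

theorem quantileScale_pos {p x : ℝ} (hp : p ∈ Ioo (0 : ℝ) 1) (hx : 0 < x) :
    0 < quantileScale p x := by
  rw [quantileScale_of_pos hp hx]; exact Real.exp_pos _

theorem one_sub_mul_gammaKernel_quantileScale_pos {p x : ℝ} (hp : p ∈ Ioo (0 : ℝ) 1)
    (hx : 0 ≤ x) (v : ℝ) :
    0 < 1 - x * (quantileScale p x * Real.exp v) *
      gammaKernel x (quantileScale p x * Real.exp v) := by
  rcases hx.eq_or_lt with rfl | hx
  · simp
  · exact one_sub_mul_gammaKernel_pos hx (mul_pos (quantileScale_pos hp hx) (Real.exp_pos _))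

theorem contDiffAt_gammaLogCorrection_quantileScale {p : ℝ} (hp : p ∈ Ioo (0 : ℝ) 1) {z : ℝ × ℝ}
    (hz : 0 ≤ z.1) :
    ContDiffAt ℝ ∞ (fun z : ℝ × ℝ =>
      gammaLogCorrection z.1 (quantileScale p z.1 * Real.exp z.2)) z := by
  have h1 : ContDiffAt ℝ ∞ (fun z : ℝ × ℝ => quantileScale p z.1 * Real.exp z.2) z :=
    ((contDiff_quantileScale p).comp contDiff_fst).contDiffAt.mul
      (Real.contDiff_exp.comp contDiff_snd).contDiffAt
  exact (contDiffAt_gammaLogCorrection (z := (z.1, quantileScale p z.1 * Real.exp z.2))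
    (by simp only; linarith) (one_sub_mul_gammaKernel_quantileScale_pos hp hz z.2)).comp
      (f := fun z : ℝ × ℝ => (z.1, quantileScale p z.1 * Real.exp z.2)) z
      (contDiffAt_fst.prodMk h1)

/-- Smoothness holds on a full neighbourhood even at x = 0, so the ordinary implicit function
theorem applies at the endpoint. -/
theorem contDiffAt_quantileEquation {p : ℝ} (hp : p ∈ Ioo (0 : ℝ) 1) {z : ℝ × ℝ} (hz : 0 ≤ z.1) :
    ContDiffAt ℝ ∞ (quantileEquation p) z := by
  have h1 : ContDiffAt ℝ ∞ (fun z : ℝ × ℝ => quantileScale p z.1 * Real.exp z.2) z :=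
    ((contDiff_quantileScale p).comp contDiff_fst).contDiffAt.mul
      (Real.contDiff_exp.comp contDiff_snd).contDiffAt
  have h2 : ContDiffAt ℝ ∞ (fun z : ℝ × ℝ => logGammaSlope z.1) z :=
    (contDiffAt_logGammaSlope (by linarith)).comp z contDiffAt_fst
  exact (contDiffAt_snd.sub h2).sub (h1.mul (contDiffAt_gammaLogCorrection_quantileScale hp hz))

theorem quantileEquation_of_pos {p x : ℝ} (hp : p ∈ Ioo (0 : ℝ) 1) (hx : 0 < x) (v : ℝ) :
    quantileEquation p (x, v) =
      (Real.log (x * lowerGamma x (quantileScale p x * Real.exp v)) - Real.log p -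
        Real.log (Real.Gamma (1 + x))) / x := by
  have h := log_sub_mul_gammaLogCorrection hx (mul_pos (quantileScale_pos hp hx) (Real.exp_pos v))
  rw [Real.log_mul (quantileScale_pos hp hx).ne' (Real.exp_pos v).ne', Real.log_exp,
    quantileScale_of_pos hp hx, Real.log_exp, ← quantileScale_of_pos hp hx] at h
  rw [quantileEquation, sub_div, sub_div, ← h, logGammaSlope_of_ne hx.ne']
  ring

theorem quantileEquation_eq_zero_iff {p x : ℝ} (hp : p ∈ Ioo (0 : ℝ) 1) (hx : 0 < x) (v : ℝ) :
    quantileEquation p (x, v) = 0 ↔ IsGammaQuantile p x (quantileScale p x * Real.exp v) := by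
  have hy := mul_pos (quantileScale_pos hp hx) (Real.exp_pos v)
  have hG := Real.Gamma_pos_of_pos hx
  have hI := lowerGamma_pos hx hy
  rw [quantileEquation_of_pos hp hx, div_eq_zero_iff, or_iff_left hx.ne', sub_sub, sub_eq_zero,
    add_comm 1 x, Real.Gamma_add_one hx.ne',
    ← Real.log_mul hp.1.ne' (by positivity), IsGammaQuantile, and_iff_right hy, ← lowerGamma]
  constructor
  · intro h
    have := Real.log_injOn_pos (mul_pos hx hI) (mul_pos hp.1 (mul_pos hx hG)) h
    have h2 : x * lowerGamma x (quantileScale p x * Real.exp v) = x * (p * Real.Gamma x) := by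
      rw [this]; ring
    exact mul_left_cancel₀ hx.ne' h2
  · intro h
    rw [h]; congr 1; ring

/-- At x = 0 the flat factor vanishes and the derivative is 1; for x > 0 it is positive because the
incomplete gamma function increases in y. -/
theorem exists_hasDerivAt_quantileEquation {p x : ℝ} (hp : p ∈ Ioo (0 : ℝ) 1) (hx : 0 ≤ x)
    (v : ℝ) :
    ∃ c : ℝ, c ≠ 0 ∧ HasDerivAt (fun v => quantileEquation p (x, v)) c v := by
  rcases hx.eq_or_lt with rfl | hx
  · refine ⟨1, one_ne_zero, ?_⟩
    simp only [quantileEquation, quantileScale_zero, zero_mul, sub_zero]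
    exact (hasDerivAt_id v).sub_const _
  · have hy := mul_pos (quantileScale_pos hp hx) (Real.exp_pos v)
    have hI := lowerGamma_pos hx hy
    have h1 := (hasDerivAt_lowerGamma hx hy).comp v
      ((Real.hasDerivAt_exp v).const_mul (quantileScale p x))
    have h2 := (((h1.const_mul x).log (mul_pos hx hI).ne').sub_const (Real.log p)).sub_const
      (Real.log (Real.Gamma (1 + x))) |>.div_const x
    refine ⟨_, ?_, h2.congr_of_eventuallyEq (Eventually.of_forall fun w => ?_)⟩
    · have := Real.rpow_pos_of_pos hy (x - 1)
      exact (div_pos (div_pos (mul_pos hx (mul_pos (mul_pos (Real.exp_pos _) this) hy))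
        (mul_pos hx hI)) hx).ne'
    · exact quantileEquation_of_pos hp hx w

/-! ### Smoothness by the implicit function theorem -/

theorem exists_contDiffAt_quantileEquation {p x : ℝ} (hp : p ∈ Ioo (0 : ℝ) 1) (hx : 0 ≤ x)
    {v : ℝ} (hv : quantileEquation p (x, v) = 0) :
    ∃ φ : ℝ → ℝ, ContDiffAt ℝ ∞ φ x ∧ φ x = v ∧ ∀ᶠ w in 𝓝 x, quantileEquation p (w, φ w) = 0 := by
  have hR := contDiffAt_quantileEquation hp (z := (x, v)) hx
  obtain ⟨c, hc, hd⟩ := exists_hasDerivAt_quantileEquation hp hx v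
  have hinv : (fderiv ℝ (quantileEquation p) (x, v) ∘L .inr ℝ ℝ ℝ).IsInvertible := by
    have hF := (hR.differentiableAt (by simp)).hasFDerivAt
    have h1 : HasFDerivAt (fun v => quantileEquation p (x, v))
        (fderiv ℝ (quantileEquation p) (x, v) ∘L .inr ℝ ℝ ℝ) v :=
      hF.comp v (hasFDerivAt_prodMk_right x v)
    have h2 := h1.unique hd.hasFDerivAt
    rw [h2]
    refine ⟨ContinuousLinearEquiv.unitsEquivAut ℝ (Units.mk0 c hc), ?_⟩
    ext
    simp
  refine ⟨hR.implicitFunction (by simp) hinv, hR.contDiffAt_implicitFunction (by simp) hinv,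
    hR.implicitFunction_apply_self (by simp) hinv, ?_⟩
  simpa [hv] using hR.eventually_apply_implicitFunction (by simp) hinv

theorem gammaQuantile_unique {p x y : ℝ} (hp : p ∈ Ioo (0 : ℝ) 1) (hx : 0 < x)
    (hy : IsGammaQuantile p x y) : gammaQuantile p x = y :=
  (existsUnique_isGammaQuantile hp hx).unique (isGammaQuantile_gammaQuantile hp hx) hy

theorem scaledGammaQuantile_pos {p : ℝ} (hp : p ∈ Ioo (0 : ℝ) 1) (x : ℝ) :
    0 < scaledGammaQuantile p x := by
  rw [scaledGammaQuantile]
  split_ifs with hx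
  · exact mul_pos (Real.exp_pos _) (isGammaQuantile_gammaQuantile hp hx).1
  · exact Real.exp_pos _

theorem gammaQuantile_eq {p x : ℝ} (hx : 0 < x) :
    gammaQuantile p x = Real.exp (Real.log p / x) * scaledGammaQuantile p x := by
  rw [scaledGammaQuantile, if_pos hx, ← mul_assoc, ← Real.exp_add, add_neg_cancel, Real.exp_zero,
    one_mul]

theorem quantileEquation_log_scaledGammaQuantile {p x : ℝ} (hp : p ∈ Ioo (0 : ℝ) 1)
    (hx : 0 ≤ x) : quantileEquation p (x, Real.log (scaledGammaQuantile p x)) = 0 := by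
  rcases hx.eq_or_lt with rfl | hx
  · simp [quantileEquation, quantileScale_zero, logGammaSlope_zero, scaledGammaQuantile]
  · rw [quantileEquation_eq_zero_iff hp hx, Real.exp_log (scaledGammaQuantile_pos hp x),
      quantileScale_of_pos hp hx, ← gammaQuantile_eq hx]
    exact isGammaQuantile_gammaQuantile hp hx

theorem eq_log_scaledGammaQuantile {p x v : ℝ} (hp : p ∈ Ioo (0 : ℝ) 1) (hx : 0 ≤ x)
    (hv : quantileEquation p (x, v) = 0) : v = Real.log (scaledGammaQuantile p x) := by
  rcases hx.eq_or_lt with rfl | hx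
  · have h : v + Real.eulerMascheroniConstant = 0 := by
      simpa [quantileEquation, quantileScale_zero, logGammaSlope_zero] using hv
    simp [scaledGammaQuantile, eq_neg_of_add_eq_zero_left h]
  · have h := gammaQuantile_unique hp hx ((quantileEquation_eq_zero_iff hp hx v).1 hv)
    rw [gammaQuantile_eq hx, quantileScale_of_pos hp hx] at h
    rw [mul_left_cancel₀ (Real.exp_pos _).ne' h, Real.log_exp]

/-- Uniqueness of the solution for each x ≥ 0 identifies the local implicit function with log u_p.
-/
theorem contDiffOn_log_scaledGammaQuantile {p : ℝ} (hp : p ∈ Ioo (0 : ℝ) 1) :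
    ContDiffOn ℝ ∞ (fun x => Real.log (scaledGammaQuantile p x)) (Ici 0) := by
  intro x hx
  obtain ⟨φ, hφ, hφx, hφe⟩ := exists_contDiffAt_quantileEquation hp hx
    (quantileEquation_log_scaledGammaQuantile hp hx)
  refine hφ.contDiffWithinAt.congr_of_eventuallyEq ?_ hφx.symm
  filter_upwards [nhdsWithin_le_nhds hφe, self_mem_nhdsWithin] with w hw hw0
  exact (eq_log_scaledGammaQuantile hp hw0 hw).symm

theorem contDiffOn_scaledGammaQuantile {p : ℝ} (hp : p ∈ Ioo (0 : ℝ) 1) :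
    ContDiffOn ℝ ∞ (scaledGammaQuantile p) (Ici 0) :=
  (Real.contDiff_exp.comp_contDiffOn (contDiffOn_log_scaledGammaQuantile hp)).congr fun x _ =>
    (Real.exp_log (scaledGammaQuantile_pos hp x)).symm

/-! ### Taylor coefficients at the endpoint -/

/-- Taylor's theorem at the endpoint of a half-line. -/
theorem ContDiffOn.isBigO_sub_taylor_Ici {f : ℝ → ℝ} (hf : ContDiffOn ℝ ∞ f (Ici 0)) (n : ℕ) :
    (fun x => f x - ∑ k ∈ Finset.range (n + 1),
      iteratedDerivWithin k f (Ici 0) 0 / (k.factorial : ℝ) * x ^ k) =O[𝓝[>] 0]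
        fun x : ℝ => x ^ (n + 1) := by
  -- Expanding to order n + 1 and absorbing the last term turns the little-o remainder into a big-O.
  have h := (taylor_isLittleO (n := n + 1) (convex_Ici 0) self_mem_Ici
    (hf.of_le (by exact_mod_cast le_top))).isBigO.mono
      (nhdsWithin_mono (0 : ℝ) Ioi_subset_Ici_self)
  simp only [sub_zero] at h
  refine (h.add ((isBigO_refl (fun x : ℝ => x ^ (n + 1)) (𝓝[>] 0)).const_mul_left
    (iteratedDerivWithin (n + 1) f (Ici 0) 0 / ((n + 1).factorial : ℝ)))).congr_left fun x => ?_
  rw [taylor_within_apply, Finset.sum_range_succ]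
  simp only [sub_zero, smul_eq_mul]
  have : ∀ k : ℕ, ((k.factorial : ℝ)⁻¹ * x ^ k) * iteratedDerivWithin k f (Ici 0) 0 =
      iteratedDerivWithin k f (Ici 0) 0 / (k.factorial : ℝ) * x ^ k := fun k => by ring
  simp only [this]
  ring

/-- Once the lower coefficients vanish, dividing by x^n and letting x → 0 kills the next one. -/
theorem eq_zero_of_sum_isBigO {c : ℕ → ℝ}
    (h : ∀ n : ℕ, (fun x : ℝ => ∑ k ∈ Finset.range (n + 1), c k * x ^ k) =O[𝓝[>] 0]
      fun x : ℝ => x ^ (n + 1)) (n : ℕ) : c n = 0 := by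
  induction n using Nat.strong_induction_on with
  | _ n ih =>
    have h1 : (fun x : ℝ => c n * x ^ n) =O[𝓝[>] 0] fun x : ℝ => x ^ (n + 1) := by
      refine (h n).congr_left fun x => ?_
      rw [Finset.sum_range_succ, Finset.sum_eq_zero, zero_add]
      intro k hk
      rw [ih k (Finset.mem_range.1 hk), zero_mul]
    have h2 : (fun _ : ℝ => c n) =O[𝓝[>] 0] fun x : ℝ => x := by
      refine (h1.mul (isBigO_refl (fun x : ℝ => (x ^ n)⁻¹) (𝓝[>] 0))).congr' ?_ ?_
      · filter_upwards [self_mem_nhdsWithin] with x hx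
        have : x ^ n ≠ 0 := pow_ne_zero n (ne_of_gt hx)
        field_simp
      · filter_upwards [self_mem_nhdsWithin] with x hx
        have : x ^ n ≠ 0 := pow_ne_zero n (ne_of_gt hx)
        field_simp
        ring
    have h3 := h2.trans_tendsto (tendsto_id.mono_left nhdsWithin_le_nhds)
    exact tendsto_nhds_unique tendsto_const_nhds h3

theorem iteratedDerivWithin_Ici_eq_of_isBigO {f g : ℝ → ℝ} (hf : ContDiffOn ℝ ∞ f (Ici 0))
    (hg : ContDiffOn ℝ ∞ g (Ici 0))
    (h : ∀ n : ℕ, (fun x => f x - g x) =O[𝓝[>] 0] fun x : ℝ => x ^ n) (k : ℕ) :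
    iteratedDerivWithin k f (Ici 0) 0 = iteratedDerivWithin k g (Ici 0) 0 := by
  have h1 := eq_zero_of_sum_isBigO (c := fun k =>
    (iteratedDerivWithin k f (Ici 0) 0 - iteratedDerivWithin k g (Ici 0) 0) / (k.factorial : ℝ))
    (fun n => ?_) k
  · have : (k.factorial : ℝ) ≠ 0 := by positivity
    rw [div_eq_zero_iff, or_iff_left this] at h1
    exact sub_eq_zero.1 h1
  · refine (((h (n + 1)).sub (hf.isBigO_sub_taylor_Ici n)).add
      (hg.isBigO_sub_taylor_Ici n)).congr_left fun x => ?_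
    simp only [sub_div, sub_mul, Finset.sum_sub_distrib]
    ring

theorem ContDiffOn.tendsto_iteratedDeriv_Ioi {f : ℝ → ℝ} (hf : ContDiffOn ℝ ∞ f (Ici 0)) (k : ℕ) :
    Tendsto (iteratedDeriv k f) (𝓝[>] 0) (𝓝 (iteratedDerivWithin k f (Ici 0) 0)) := by
  have h := (hf.continuousOn_iteratedDerivWithin (m := k) (by exact_mod_cast le_top)
    (uniqueDiffOn_Ici 0) 0 self_mem_Ici).mono_left (nhdsWithin_mono (0 : ℝ) Ioi_subset_Ici_self)
  refine h.congr' ?_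
  filter_upwards [self_mem_nhdsWithin] with x hx
  exact iteratedDerivWithin_eq_iteratedDeriv (uniqueDiffOn_Ici 0)
    (((hf.contDiffAt (Ici_mem_nhds hx)).of_le (by exact_mod_cast le_top))) (Ioi_subset_Ici_self hx)

/-! ### Independence of p and the expansion -/

theorem scaledGammaQuantile_sub_isBigO {p : ℝ} (hp : p ∈ Ioo (0 : ℝ) 1) (n : ℕ) :
    (fun x => scaledGammaQuantile p x - Real.exp (logGammaSlope x)) =O[𝓝[>] 0]
      fun x : ℝ => x ^ n := by
  set v : ℝ → ℝ := fun x => Real.log (scaledGammaQuantile p x) with hv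
  have hv0 : v 0 = -Real.eulerMascheroniConstant := by simp [hv, scaledGammaQuantile]
  have hvt : Tendsto v (𝓝[>] 0) (𝓝 (-Real.eulerMascheroniConstant)) := by
    rw [← hv0]
    exact ((contDiffOn_log_scaledGammaQuantile hp).continuousOn 0 self_mem_Ici).mono_left
      (nhdsWithin_mono (0 : ℝ) Ioi_subset_Ici_self)
  have hLt : Tendsto logGammaSlope (𝓝[>] 0) (𝓝 (-Real.eulerMascheroniConstant)) := by
    rw [← logGammaSlope_zero]
    exact (contDiffAt_logGammaSlope (by norm_num)).continuousAt.tendsto.mono_left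
      nhdsWithin_le_nhds
  have hxt : Tendsto (fun x : ℝ => x) (𝓝[>] 0) (𝓝 0) := tendsto_id.mono_left nhdsWithin_le_nhds
  have hMt := ((contDiffAt_gammaLogCorrection_quantileScale hp
    (z := (0, -Real.eulerMascheroniConstant)) le_rfl).continuousAt.tendsto.comp
      (hxt.prodMk_nhds hvt)).isBigO_one ℝ
  have hEt := ((Real.continuous_exp.tendsto _).comp hvt).isBigO_one ℝ
  -- The difference equals s e^v M: s is flat, and the other two factors converge, hence are
  -- bounded.
  have hsub : (fun x => v x - logGammaSlope x) =O[𝓝[>] 0] fun x : ℝ => x ^ n := by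
    refine (((quantileScale_isBigO hp n).mul hEt).mul hMt).congr' ?_ (by simp [EventuallyEq.refl])
    filter_upwards [self_mem_nhdsWithin] with x hx
    have h := quantileEquation_log_scaledGammaQuantile hp (le_of_lt hx)
    simp only [quantileEquation, Function.comp] at h ⊢
    linarith
  -- Strict differentiability at the common limit -γ bounds e^v - e^L by a multiple of v - L.
  have hexp := ((Real.hasStrictDerivAt_exp (-Real.eulerMascheroniConstant)).isBigO_sub.comp_tendsto
    (hvt.prodMk_nhds hLt)).trans hsub
  refine hexp.congr_left fun x => ?_
  simp [hv, Real.exp_log (scaledGammaQuantile_pos hp x)]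

theorem scaledGammaQuantileDerivZero_eq {p : ℝ} (hp : p ∈ Ioo (0 : ℝ) 1) (k : ℕ) :
    scaledGammaQuantileDerivZero p k =
      iteratedDerivWithin k (fun x => Real.exp (logGammaSlope x)) (Ici 0) 0 := by
  refine iteratedDerivWithin_Ici_eq_of_isBigO (contDiffOn_scaledGammaQuantile hp) ?_
    (scaledGammaQuantile_sub_isBigO hp) k
  intro x hx
  have hx : (0 : ℝ) ≤ x := hx
  exact (contDiffAt_logGammaSlope (by linarith)).exp.contDiffWithinAt

theorem mainTheorem5 :
    (∀ p : ℝ, p ∈ Ioo (0 : ℝ) 1 →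
      ContDiffOn ℝ ∞ (scaledGammaQuantile p) (Ici 0) ∧
      (∀ k : ℕ, Tendsto (iteratedDeriv k (scaledGammaQuantile p)) (𝓝[>] 0)
        (𝓝 (scaledGammaQuantileDerivZero p k))) ∧
      ∀ n : ℕ, ∃ r : ℝ → ℝ, r =O[𝓝[>] 0] (fun x : ℝ => x ^ (n + 1)) ∧
        ∀ x : ℝ, 0 < x →
          gammaQuantile p x = Real.exp (Real.log p / x) *
            (∑ k ∈ Finset.range (n + 1),
              scaledGammaQuantileDerivZero p k / (k.factorial : ℝ) * x ^ k + r x)) ∧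
    (∀ p q : ℝ, p ∈ Ioo (0 : ℝ) 1 → q ∈ Ioo (0 : ℝ) 1 → ∀ k : ℕ,
      scaledGammaQuantileDerivZero p k = scaledGammaQuantileDerivZero q k) := by
  refine ⟨fun p hp => ?_, fun p q hp hq k => ?_⟩
  · have hsmooth := contDiffOn_scaledGammaQuantile hp
    refine ⟨hsmooth, hsmooth.tendsto_iteratedDeriv_Ioi, fun n =>
      ⟨_, hsmooth.isBigO_sub_taylor_Ici n, fun x hx => ?_⟩⟩
    rw [gammaQuantile_eq hx]
    simp only [scaledGammaQuantileDerivZero, add_sub_cancel]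
  · rw [scaledGammaQuantileDerivZero_eq hp, scaledGammaQuantileDerivZero_eq hq]
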